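/- Let $p\ge 5$ be prime. For $k\in\mathbb{Z}$ let $M_k$ be the space of modular forms of weight $k$ on $\mathrm{SL}_2(\mathbb{Z})$ whose Fourier coefficients lie in the ring $\mathbb{Z}_{(p)}$ of $p$-integral rational numbers, each form being identified with its Fourier expansion $\sum_{n\ge 0} a(n)q^n\in\mathbb{Z}_{(p)}[\![q]\!]$; congruences modulo $p^m$ between such series are understood coefficientwise. Let $E_0=1$ and, for even $k\ge 2$, let $$E_k=1-\frac{2k}{B_k}\sum_{n\ge 1}\sigma_{k-1}(n)q^n,$$ where $B_k$ is the $k$-th Bernoulli number and $\sigma_{k-1}(n)=\sum_{d\mid n}d^{k-1}$. For $m\ge 1$ and $f$ in some $M_{k'}$, the factor filtration of $f$ modulo $p^m$ is $$\tilde\omega_{p^m}(f)=\inf\{w:\ f\equiv E_{p-1}^{\,n}\,g \pmod{p^m}\ \text{ for some } n\ge 0 \text{ and some } g\in M_w\}.$$ Let $k\ge 0$ be an integer with $(p-1)\mid k$ and let $1\le m\le p-1$. Then $E_k\in M_k$ and $$\tilde\omega_{p^m}(E_k)\le (m-1)(p-1).$$ That is, $E_k$ is congruent modulo $p^m$ to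 a power of $E_{p-1}$ times an element of $M_w$ for some $w\le (m-1)(p-1)$. -/

import Mathlib

open scoped MatrixGroups

noncomputable section

/-- `x ∈ ℤ_(p)`: the rational number `x` is `p`-integral, i.e. `p` does not divide the
denominator of `x` in lowest terms. -/
def IsPIntegral (p : ℕ) (x : ℚ) : Prop := ¬ p ∣ x.den

/-- The `q`-expansion of the normalized Eisenstein series of weight `k`,
`E_k = 1 - (2k / B_k) ∑_{n ≥ 1} σ_{k-1}(n) q^n` (meant for even `k ≥ 2`), with `E_0 = 1`. -/
def eisensteinSeriesE (k : ℕ) : PowerSeries ℚ :=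
  if k = 0 then 1
  else PowerSeries.mk fun n =>
    if n = 0 then 1
    else -(2 * (k : ℚ) / bernoulli k) * ((ArithmeticFunction.sigma (k - 1) n : ℕ) : ℚ)

/-- The set `M_k` of modular forms of weight `k` on `SL₂(ℤ)` whose Fourier coefficients are
`p`-integral rational numbers; a form is identified with its Fourier expansion. -/
def integralModularForms (p : ℕ) (k : ℤ) : Set (PowerSeries ℚ) :=
  {f | (∀ n, IsPIntegral p (PowerSeries.coeff n f)) ∧
    ∃ F : ModularForm 𝒮ℒ k,
      UpperHalfPlane.qExpansion 1 F = PowerSeries.map (algebraMap ℚ ℂ) f}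

/-- The coefficientwise congruence `f ≡ g (mod p^m)`: every coefficient of `f - g` lies in
`p^m ℤ_(p)`. -/
def CongrModPow (p m : ℕ) (f g : PowerSeries ℚ) : Prop :=
  ∀ n, ∃ c : ℚ, IsPIntegral p c ∧
    PowerSeries.coeff n f - PowerSeries.coeff n g = (p : ℚ) ^ m * c

/-- The factor filtration of `f` modulo `p^m`: the infimum of the weights `k` such that
`f ≡ E_{p-1}^n g (mod p^m)` for some `n ≥ 0` and some `g ∈ M_k`. It is taken in the extended
reals, so that the infimum of the empty set is `⊤`. -/
def factorFiltration (p m : ℕ) (f : PowerSeries ℚ) : EReal :=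
  sInf {w : EReal | ∃ k : ℤ, w = ((k : ℝ) : EReal) ∧
    ∃ n : ℕ, ∃ g ∈ integralModularForms p k,
      CongrModPow p m f (eisensteinSeriesE (p - 1) ^ n * g)}

end

/-! Write `k = (p-1)r` and `e = E_{p-1}`. The family `r ↦ E_{(p-1)r}`, with value `1` at `r = 0`,
satisfies `Δ^j ∈ p^j` for all `j ≤ p-1`. Since `e ≡ 1 (mod p)`, the same divisibility holds for the
powers of `D = S - e`, where `S` is the shift. Expanding `S^r = (D + e)^r` at `0` and dropping the
terms with `j ≥ m` gives, modulo `p^m`, a combination of products `e^(r-i) E_{(p-1)i}` with `i ≤ j <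
m`. Twisting by `e` instead of `1` keeps every term in weight `(p-1)r`, and `e^(r-m+1)` factors out,
leaving weight `(p-1)(m-1)` (`newton_congr`, `eisensteinSeriesE_congr_pow_mul`).

Regularity of the family reduces to Bernoulli numbers. For `β_s = p B_{(p-1)s} - [s = 0]`, the
difference `Δ^j β_s` is the value of `f ↦ p L(f) - f(0)`, with `L(X^n) = B_n`, at `X^((p-1)s)
(X^(p-1) - 1)^j`. The distribution relation `p L(f) = ∑_{a<p} L(f(a + pX))` shows that this is
divisible by `p^j` for `j ≤ p-2`. As `β_s ≡ -1 (mod p)`, inversion preserves this, and the factor `p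
r` in `2k/B_k = 2(p-1) · p r / β_r` gains the last order. -/

/-! ### Calculus of sequences with divisible differences. -/

/-- The sequences `f : ℕ → A` with values in the subring `R` whose iterated differences satisfy
`Δ^j f ∈ p^j R` for `j ≤ M`, in recursive form. -/
def HasDivisibleDifferences {A : Type*} [CommRing A] (R : Subring A) (p : ℕ) :
    ℕ → (ℕ → A) → Prop
  | 0, f => ∀ s, f s ∈ R
  | M + 1, f => (∀ s, f s ∈ R) ∧
      ∃ g, HasDivisibleDifferences R p M g ∧ ∀ s, f (s + 1) = f s + p * g s

namespace HasDivisibleDifferences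

variable {A : Type*} [CommRing A] {R : Subring A} {p : ℕ}

lemma mem {M : ℕ} {f : ℕ → A} (hf : HasDivisibleDifferences R p M f) (s : ℕ) : f s ∈ R := by
  cases M with
  | zero => exact hf s
  | succ M => exact hf.1 s

lemma of_succ {M : ℕ} {f : ℕ → A} (hf : HasDivisibleDifferences R p (M + 1) f) :
    HasDivisibleDifferences R p M f := by
  induction M generalizing f with
  | zero => exact hf.mem
  | succ M ih =>
    obtain ⟨h0, g, hg, h⟩ := hf
    exact ⟨h0, g, ih hg, h⟩

lemma shift {M : ℕ} {f : ℕ → A} (hf : HasDivisibleDifferences R p M f) :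
    HasDivisibleDifferences R p M fun s => f (s + 1) := by
  induction M generalizing f with
  | zero => exact fun s => hf _
  | succ M ih =>
    obtain ⟨h0, g, hg, h⟩ := hf
    exact ⟨fun s => h0 _, _, ih hg, fun s => h _⟩

lemma const (M : ℕ) {c : A} (hc : c ∈ R) : HasDivisibleDifferences R p M fun _ => c := by
  induction M generalizing c with
  | zero => exact fun _ => hc
  | succ M ih => exact ⟨fun _ => hc, _, ih R.zero_mem, by simp⟩

lemma add {M : ℕ} {f g : ℕ → A} (hf : HasDivisibleDifferences R p M f)
    (hg : HasDivisibleDifferences R p M g) :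
    HasDivisibleDifferences R p M fun s => f s + g s := by
  induction M generalizing f g with
  | zero => exact fun s => R.add_mem (hf s) (hg s)
  | succ M ih =>
    obtain ⟨h0, f', hf', h⟩ := hf
    obtain ⟨h0', g', hg', h'⟩ := hg
    exact ⟨fun s => R.add_mem (h0 s) (h0' s), _, ih hf' hg', fun s => by simp only [h, h']; ring⟩

lemma mul {M : ℕ} {f g : ℕ → A} (hf : HasDivisibleDifferences R p M f)
    (hg : HasDivisibleDifferences R p M g) :
    HasDivisibleDifferences R p M fun s => f s * g s := by
  induction M generalizing f g with
  | zero => exact fun s => R.mul_mem (hf s) (hg s)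
  | succ M ih =>
    have hf0 := hf.of_succ
    have hg0 := hg.of_succ.shift
    obtain ⟨h0, f', hf', h⟩ := hf
    obtain ⟨h0', g', hg', h'⟩ := hg
    exact ⟨fun s => R.mul_mem (h0 s) (h0' s), _, (ih hf0 hg').add (ih hf' hg0),
      fun s => by simp only [h, h']; ring⟩

lemma sum {ι : Type*} {M : ℕ} (t : Finset ι) {f : ι → ℕ → A}
    (hf : ∀ i ∈ t, HasDivisibleDifferences R p M (f i)) :
    HasDivisibleDifferences R p M fun s => ∑ i ∈ t, f i s := by
  classical
  induction t using Finset.induction_on with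
  | empty => simpa using const M R.zero_mem
  | insert a t ha ih =>
    simp only [Finset.sum_insert ha]
    exact (hf a (by simp)).add (ih fun i hi => hf i (by simp [hi]))

lemma pow_mul {M : ℕ} {f : ℕ → A} (hf : ∀ s, f s ∈ R) :
    HasDivisibleDifferences R p M fun s => (p : A) ^ M * f s := by
  induction M generalizing f with
  | zero => simpa [HasDivisibleDifferences] using hf
  | succ M ih =>
    refine ⟨fun s => R.mul_mem (R.pow_mem (natCast_mem R p) _) (hf s), _,
      ih (f := fun s => f (s + 1) - f s) fun s => R.sub_mem (hf _) (hf _), fun s => by ring⟩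

lemma geom (M : ℕ) {y : A} (hy : y ∈ R) :
    HasDivisibleDifferences R p M fun s => (1 + p * y) ^ s := by
  have h1 : ∀ s : ℕ, (1 + p * y) ^ s ∈ R := fun s =>
    R.pow_mem (R.add_mem R.one_mem (R.mul_mem (natCast_mem R p) hy)) s
  induction M with
  | zero => exact h1
  | succ M ih => exact ⟨h1, _, (const M hy).mul ih, fun s => by ring⟩

/-- The gain of one order comes from `Δ(s f) = f(s+1) + s Δf`: the prefactor `p` pays for the first
difference, and `s Δf = p s g` has the same shape one order lower. -/
lemma natCast_mul {M : ℕ} {f : ℕ → A} (hf : HasDivisibleDifferences R p M f) :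
    HasDivisibleDifferences R p (M + 1) fun s => p * s * f s := by
  have h1 : ∀ s : ℕ, (p * s * f s : A) ∈ R := fun s =>
    R.mul_mem (R.mul_mem (natCast_mem R p) (natCast_mem R s)) (hf.mem s)
  induction M generalizing f with
  | zero =>
    refine ⟨h1, fun s => (s + 1) * f (s + 1) - s * f s, fun s => ?_, fun s => by push_cast; ring⟩
    exact R.sub_mem (R.mul_mem (R.add_mem (natCast_mem R s) R.one_mem) (hf _))
      (R.mul_mem (natCast_mem R s) (hf _))
  | succ M ih =>
    have h2 := hf.shift
    obtain ⟨h0, g, hg, h⟩ := hf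
    refine ⟨h1, fun s => f (s + 1) + p * s * g s, h2.add (ih hg fun s => ?_), fun s => ?_⟩
    · exact R.mul_mem (R.mul_mem (natCast_mem R p) (natCast_mem R s)) (hg.mem s)
    · push_cast [h]; ring

/-- `Δ(1/f) = -Δf / (f(s) f(s+1))`, so closure under products and shifts gives the next order. -/
lemma inv {K : Type*} [Field K] {R : Subring K} {M : ℕ} {f : ℕ → K}
    (hf : HasDivisibleDifferences R p M f) (h0 : ∀ s, f s ≠ 0) (hi : ∀ s, (f s)⁻¹ ∈ R) :
    HasDivisibleDifferences R p M fun s => (f s)⁻¹ := by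
  induction M with
  | zero => exact hi
  | succ M ih =>
    have h1 := ih hf.of_succ
    obtain ⟨_, g, hg, h⟩ := hf
    refine ⟨hi, _, (const M (R.neg_mem R.one_mem)).mul ((hg.mul h1).mul h1.shift), fun s => ?_⟩
    have h2 := h s
    have h3 := h0 s
    have h4 := h0 (s + 1)
    field_simp
    rw [h2]; ring

/-- Here `ψ j` plays the role of `Δ^j f / p^j`. -/
lemma of_iterated_differences {M : ℕ} (ψ : ℕ → ℕ → A) (hψ : ∀ j ≤ M, ∀ s, ψ j s ∈ R)
    (h : ∀ j s, ψ j (s + 1) = ψ j s + p * ψ (j + 1) s) : HasDivisibleDifferences R p M (ψ 0) := by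
  induction M generalizing ψ with
  | zero => exact hψ 0 le_rfl
  | succ M ih =>
    exact ⟨hψ 0 (Nat.zero_le _), ψ 1, ih (fun j => ψ (j + 1))
      (fun j hj => hψ (j + 1) (by omega)) fun j => h (j + 1), h 0⟩

lemma congr {M : ℕ} {f g : ℕ → A} (hf : HasDivisibleDifferences R p M f) (h : ∀ s, g s = f s) :
    HasDivisibleDifferences R p M g := by
  rwa [funext h]

/-- The shift operator on sequences. -/
def shiftOp (A : Type*) [CommRing A] : Module.End A (ℕ → A) where
  toFun f s := f (s + 1)
  map_add' _ _ := rfl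
  map_smul' _ _ := rfl

lemma shiftOp_pow_apply (n : ℕ) (f : ℕ → A) (s : ℕ) : (shiftOp A ^ n) f s = f (s + n) := by
  induction n generalizing s with
  | zero => rfl
  | succ n ih =>
    rw [pow_succ', Module.End.mul_apply]
    change (shiftOp A ^ n) f (s + 1) = _
    rw [ih]; congr 1; omega

/-- If `Δg = p g'`, then `(S - 1 - p y) g = p (g' - y g)`. Each application thus trades one order of
regularity for a factor `p`; once the orders are spent, the operator still preserves `R`. -/
lemma shiftOp_sub_pow {M : ℕ} {f : ℕ → A} {y : A} (hf : HasDivisibleDifferences R p M f)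
    (hy : y ∈ R) (j : ℕ) :
    ∃ g, HasDivisibleDifferences R p (M - j) g ∧
      ∀ s, ((shiftOp A - algebraMap A _ (1 + p * y)) ^ j) f s = (p : A) ^ min j M * g s := by
  induction j with
  | zero => exact ⟨f, hf, by simp⟩
  | succ j ih =>
    obtain ⟨g, hg, h⟩ := ih
    have key : ∀ s, ((shiftOp A - algebraMap A _ (1 + p * y)) ^ (j + 1)) f s =
        (p : A) ^ min j M * (g (s + 1) - (1 + p * y) * g s) := by
      intro s
      rw [pow_succ', Module.End.mul_apply, LinearMap.sub_apply, Pi.sub_apply,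
        Module.algebraMap_end_apply, Pi.smul_apply, smul_eq_mul, h]
      rw [show shiftOp A (((shiftOp A - algebraMap A _ (1 + p * y)) ^ j) f) s =
        ((shiftOp A - algebraMap A _ (1 + p * y)) ^ j) f (s + 1) from rfl, h]
      ring
    rcases lt_or_ge j M with hj | hj
    · obtain ⟨N, hN⟩ : ∃ N, M - j = N + 1 := ⟨M - j - 1, by omega⟩
      rw [hN] at hg
      have h1 := hg.of_succ
      obtain ⟨_, g', hg', h'⟩ := hg
      refine ⟨fun s => g' s + -y * g s, ?_, fun s => ?_⟩
      · rw [show M - (j + 1) = N by omega]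
        exact hg'.add ((const N (R.neg_mem hy)).mul h1)
      · rw [key, h', min_eq_left hj.le, min_eq_left (by omega)]; ring
    · refine ⟨_, ?_, fun s => by rw [key, min_eq_right hj, min_eq_right (by omega)]⟩
      rw [show M - (j + 1) = 0 by omega]
      exact fun s => R.sub_mem (hg.mem _) (R.mul_mem (R.add_mem R.one_mem
        (R.mul_mem (natCast_mem R p) hy)) (hg.mem s))

/-- Newton interpolation twisted by an element `e ≡ 1 (mod p)`. -/
lemma newton_congr {M : ℕ} {f : ℕ → A} {e y : A} (hf : HasDivisibleDifferences R p M f)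
    (hy : y ∈ R) (he : e = 1 + p * y) {r : ℕ} (hr : M ≤ r + 1) :
    ∃ c ∈ R, f r = ∑ j ∈ Finset.range M, (r.choose j : A) * e ^ (r - j) *
      ∑ i ∈ Finset.range (j + 1), (j.choose i : A) * (-e) ^ (j - i) * f i + (p : A) ^ M * c := by
  have expand : ∀ (u : A) (D : Module.End A (ℕ → A)) (n : ℕ),
      ((D + algebraMap A _ u) ^ n) f 0 =
        ∑ j ∈ Finset.range (n + 1), (n.choose j : A) * u ^ (n - j) * (D ^ j) f 0 := by
    intro u D n
    rw [Commute.add_pow (show Commute D _ from (Algebra.commutes u D).symm), LinearMap.sum_apply,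
      Finset.sum_apply]
    refine Finset.sum_congr rfl fun j _ => ?_
    rw [← map_pow, ← map_natCast (algebraMap A (Module.End A (ℕ → A))), mul_assoc, ← map_mul,
      ← Algebra.commutes, Module.End.mul_apply, Module.algebraMap_end_apply, Pi.smul_apply,
      smul_eq_mul, mul_comm (u ^ _)]
  -- The binomial expansion is used twice: `S^r = (D + e)^r` yields the Newton series, and `D^j = (S
  -- - e)^j` writes its coefficients through `f 0, …, f j`.
  set D := shiftOp A - algebraMap A _ e with hD
  have h1 : f r = ∑ j ∈ Finset.range (r + 1), (r.choose j : A) * e ^ (r - j) * (D ^ j) f 0 := by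
    rw [← expand, hD, sub_add_cancel, shiftOp_pow_apply, zero_add]
  have h2 : ∀ j, (D ^ j) f 0 =
      ∑ i ∈ Finset.range (j + 1), (j.choose i : A) * (-e) ^ (j - i) * f i := by
    intro j
    have := expand (-e) (shiftOp A) j
    rw [map_neg, ← sub_eq_add_neg, ← hD] at this
    simpa [shiftOp_pow_apply] using this
  have he' : e ∈ R := he ▸ R.add_mem R.one_mem (R.mul_mem (natCast_mem R p) hy)
  have h3 : ∀ j, M ≤ j → ∃ c ∈ R, (D ^ j) f 0 = (p : A) ^ M * c := by
    intro j hj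
    obtain ⟨g, hg, h⟩ := hf.shiftOp_sub_pow hy j
    exact ⟨g 0, hg.mem 0, by rw [hD, he, h, min_eq_right hj]⟩
  choose! c hc h3 using h3
  refine ⟨∑ j ∈ Finset.Ico M (r + 1), (r.choose j : A) * e ^ (r - j) * c j,
    R.sum_mem fun j hj => R.mul_mem (R.mul_mem (natCast_mem R _) (R.pow_mem he' _))
      (hc j (Finset.mem_Ico.1 hj).1), ?_⟩
  rw [h1, ← Finset.sum_range_add_sum_Ico _ hr, Finset.mul_sum]
  congr 1
  · exact Finset.sum_congr rfl fun j _ => by rw [h2]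
  · refine Finset.sum_congr rfl fun j hj => ?_
    rw [h3 j (Finset.mem_Ico.1 hj).1]; ring

end HasDivisibleDifferences

/-! ### Moment functionals, `p`-integral rationals and the Bernoulli distribution relation. -/

open Polynomial in
/-- The linear functional on `ℤ[X]` with moments `b n`. -/
def momentFunctional (b : ℕ → ℚ) : ℤ[X] →ₗ[ℤ] ℚ :=
  lsum fun n => LinearMap.toSpanSingleton ℤ ℚ (b n)

open Polynomial in
lemma momentFunctional_apply (b : ℕ → ℚ) (g : ℤ[X]) :
    momentFunctional b g = g.sum fun n c => (c : ℚ) * b n := by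
  simp [momentFunctional]

open Polynomial in
lemma momentFunctional_monomial (b : ℕ → ℚ) (n : ℕ) (c : ℤ) :
    momentFunctional b (monomial n c) = c * b n := by
  rw [momentFunctional_apply, sum_monomial_index _ _ (by simp)]

open Polynomial in
lemma momentFunctional_X_pow (b : ℕ → ℚ) (n : ℕ) : momentFunctional b (X ^ n) = b n := by
  rw [← monomial_one_right_eq_X_pow, momentFunctional_monomial]; simp

/-- The subring of `p`-integral rational numbers. -/
def pIntegers (p : ℕ) [Fact p.Prime] : Subring ℚ := (Rat.padicValuation p).integer

lemma mem_pIntegers {p : ℕ} [Fact p.Prime] {x : ℚ} : x ∈ pIntegers p ↔ IsPIntegral p x :=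
  Rat.padicValuation_le_one_iff

lemma inv_natCast_mem_pIntegers {p : ℕ} [hp : Fact p.Prime] {n : ℕ} (hn : ¬ p ∣ n) :
    (n : ℚ)⁻¹ ∈ pIntegers p := by
  have h0 : 0 < n := Nat.pos_of_ne_zero fun h => hn (h ▸ dvd_zero p)
  rw [mem_pIntegers, IsPIntegral, Rat.inv_natCast_den_of_pos h0]
  exact hn

lemma inv_mem_pIntegers {p : ℕ} [hp : Fact p.Prime] {x c : ℚ} {n : ℤ} (hn : ¬ (p : ℤ) ∣ n)
    (hc : c ∈ pIntegers p) (hx : x = n + p * c) : x ≠ 0 ∧ x⁻¹ ∈ pIntegers p := by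
  have hd : ¬ p ∣ c.den := mem_pIntegers.1 hc
  have hd0 : (c.den : ℚ) ≠ 0 := by exact_mod_cast c.den_nz
  set N : ℤ := n * c.den + p * c.num with hN
  have hxN : x = N / c.den := by
    rw [hx, hN]; push_cast; rw [add_div, mul_div_cancel_right₀ _ hd0, mul_div_assoc, Rat.num_div_den]
  have hpN : ¬ (p : ℤ) ∣ N := by
    intro h
    rw [hN, Int.dvd_add_left (dvd_mul_right _ _),
      (Nat.prime_iff_prime_int.1 hp.out).dvd_mul] at h
    rcases h with h | h
    · exact hn h
    · exact hd (by exact_mod_cast h)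
  have hN0 : (N : ℚ) ≠ 0 := by
    intro h
    exact hpN (by rw [Int.cast_eq_zero.1 h]; exact dvd_zero _)
  refine ⟨by rw [hxN]; exact div_ne_zero hN0 hd0, ?_⟩
  have hinv : (N : ℚ)⁻¹ ∈ pIntegers p := by
    rw [mem_pIntegers, IsPIntegral, Rat.inv_intCast_den, if_neg (by exact_mod_cast hN0)]
    exact fun h => hpN (Int.natCast_dvd.2 h)
  rw [hxN, inv_div, div_eq_mul_inv]
  exact (pIntegers p).mul_mem (natCast_mem _ _) hinv

/-- This is the multiplication theorem for Bernoulli polynomials at `x = 0`, with each `B_n(a/p)`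
expanded and denominators cleared. -/
lemma natCast_mul_bernoulli_eq_sum (n : ℕ) {p : ℕ} (hp : p ≠ 0) :
    (p : ℚ) * bernoulli n = ∑ a ∈ Finset.range p, ∑ i ∈ Finset.range (n + 1),
      (n.choose i : ℚ) * (a : ℚ) ^ (n - i) * ((p : ℚ) ^ i * bernoulli i) := by
  have hp' : (p : ℝ) ≠ 0 := by exact_mod_cast hp
  have h := bernoulliFun_mul n hp 0
  rw [mul_zero, bernoulliFun_eval_zero] at h
  have h2 : (p : ℝ) * (bernoulli n : ℚ) = ∑ a ∈ Finset.range p, ∑ i ∈ Finset.range (n + 1),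
      (n.choose i : ℝ) * (a : ℝ) ^ (n - i) * ((p : ℝ) ^ i * (bernoulli i : ℚ)) := by
    rw [h, ← mul_assoc, mul_div_cancel₀ _ hp', Finset.mul_sum]
    refine Finset.sum_congr rfl fun a _ => ?_
    rw [zero_add, bernoulliFun, Polynomial.bernoulli, Polynomial.map_sum,
      Polynomial.eval_finsetSum, Finset.mul_sum]
    refine Finset.sum_congr rfl fun i hi => ?_
    rw [Polynomial.map_monomial, Polynomial.eval_monomial, div_pow]
    obtain ⟨j, rfl⟩ := Nat.exists_eq_add_of_le (Nat.lt_succ_iff.1 (Finset.mem_range.1 hi))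
    rw [Nat.add_sub_cancel_left, pow_add]
    simp only [map_mul, eq_ratCast, Rat.cast_natCast]
    field_simp
  exact_mod_cast h2

open Polynomial in
/-- The distribution relation of the Bernoulli functional `X ^ n ↦ B_n`. -/
lemma momentFunctional_bernoulli_distribution {p : ℕ} (hp : p ≠ 0) (f : ℤ[X]) :
    (p : ℚ) * momentFunctional _root_.bernoulli f = ∑ a ∈ Finset.range p,
      momentFunctional (fun n => (p : ℚ) ^ n * _root_.bernoulli n) (f.comp (X + C (a : ℤ))) := by
  induction f using Polynomial.induction_on' with
  | add f g hf hg => simp only [add_comp, map_add, mul_add, hf, hg, Finset.sum_add_distrib]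
  | monomial n c =>
    rw [momentFunctional_monomial, mul_left_comm, natCast_mul_bernoulli_eq_sum n hp,
      Finset.mul_sum]
    refine Finset.sum_congr rfl fun a _ => ?_
    rw [monomial_comp, ← smul_eq_C_mul, map_smul, add_pow, map_sum, zsmul_eq_mul]
    congr 1
    refine Finset.sum_congr rfl fun i _ => ?_
    rw [show (X ^ i * C (a : ℤ) ^ (n - i) * (n.choose i : ℤ[X])) =
      monomial i ((a : ℤ) ^ (n - i) * (n.choose i : ℤ)) by
        rw [← C_mul_X_pow_eq_monomial]; simp; ring, momentFunctional_monomial]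
    push_cast; ring

open Polynomial in
/-- Membership of an integral polynomial in the `j`-th power of the ideal `(p, X)`. -/
def MemPowIdeal (p j : ℕ) (g : ℤ[X]) : Prop := ∀ n, (p : ℤ) ^ (j - n) ∣ g.coeff n

namespace MemPowIdeal

open Polynomial

lemma mul {p i j : ℕ} {g h : ℤ[X]} (hg : MemPowIdeal p i g) (hh : MemPowIdeal p j h) :
    MemPowIdeal p (i + j) (g * h) := by
  intro n
  rw [coeff_mul]
  refine Finset.dvd_sum fun x hx => ?_
  rw [Finset.HasAntidiagonal.mem_antidiagonal] at hx
  refine (pow_dvd_pow _ ?_).trans ((pow_add (p : ℤ) (i - x.1) (j - x.2)).dvd.trans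
    (mul_dvd_mul (hg _) (hh _)))
  omega

lemma zero (p : ℕ) (g : ℤ[X]) : MemPowIdeal p 0 g := fun n => by simp

lemma pow {p : ℕ} {g : ℤ[X]} (hg : MemPowIdeal p 1 g) (j : ℕ) : MemPowIdeal p j (g ^ j) := by
  induction j with
  | zero => exact zero _ _
  | succ j ih => rw [pow_succ]; exact ih.mul hg

end MemPowIdeal

/-! ### `p`-adic regularity of the Bernoulli numbers. -/

section Prime

variable {p : ℕ} [hp : Fact p.Prime]

/-- The recursion for `B_n` divides only by integers at most `n + 1 < p`. -/
lemma bernoulli_mem_pIntegers_of_lt {n : ℕ} (hn : n < p - 1) : bernoulli n ∈ pIntegers p := by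
  rw [bernoulli]
  refine (pIntegers p).mul_mem (Subring.pow_mem _ (neg_mem (one_mem _)) _) ?_
  induction n using Nat.strong_induction_on with
  | _ n ih =>
    rw [bernoulli'_def]
    refine sub_mem (one_mem _) (sum_mem fun k hk => ?_)
    rw [Finset.mem_range] at hk
    rw [div_mul_eq_mul_div, div_eq_mul_inv]
    refine mul_mem (mul_mem (natCast_mem _ _) (ih k hk (hk.trans hn))) ?_
    rw [← Nat.cast_sub hk.le, ← Nat.cast_one, ← Nat.cast_add]
    exact inv_natCast_mem_pIntegers (Nat.not_dvd_of_pos_of_lt (by omega) (by omega))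

lemma natCast_mul_bernoulli_mem_pIntegers (hp2 : p ≠ 2) (n : ℕ) :
    (p : ℚ) * _root_.bernoulli n ∈ pIntegers p := by
  have hp1 := hp.out.two_le
  rcases lt_or_ge n (p - 1) with h | h
  · exact mul_mem (natCast_mem _ _) (bernoulli_mem_pIntegers_of_lt h)
  rcases Nat.even_or_odd' n with ⟨k, rfl | rfl⟩
  · obtain ⟨c, hc⟩ := Bernoulli.vonStaudt_clausen k
    rw [← sub_eq_iff_eq_add] at hc
    rw [← hc, mul_sub, Finset.mul_sum]
    refine sub_mem (mul_mem (natCast_mem _ _) (intCast_mem _ _)) (sum_mem fun q hq => ?_)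
    rw [Finset.mem_filter] at hq
    by_cases hqp : q = p
    · rw [hqp, mul_one_div_cancel (by exact_mod_cast hp.out.ne_zero)]
      exact one_mem _
    · rw [one_div]
      refine mul_mem (natCast_mem _ _) (inv_natCast_mem_pIntegers fun h => hqp ?_)
      exact ((Nat.prime_dvd_prime_iff_eq hp.out hq.2.1).1 h).symm
  · rw [bernoulli_eq_zero_of_odd ⟨k, rfl⟩ (by omega), mul_zero]
    exact zero_mem _

-- Below degree `p-1` the `B_n` are `p`-integral and the hypothesis on `g` supplies `p^j`. From
-- degree `p-1` on, `p^n B_n = p^(n-1) · p B_n` with `n - 1 ≥ p - 2 ≥ j`, so no condition on the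
-- coefficient is needed.
open Polynomial in
lemma momentFunctional_mem_pow {j : ℕ} (hp2 : p ≠ 2) (hj : j ≤ p - 2) {g : ℤ[X]}
    (hg : ∀ n < p - 1, (p : ℤ) ^ (j - n) ∣ g.coeff n) :
    ∃ c ∈ pIntegers p,
      momentFunctional (fun n => (p : ℚ) ^ n * _root_.bernoulli n) g = (p : ℚ) ^ j * c := by
  have key : ∀ n, ∃ c ∈ pIntegers p,
      (g.coeff n : ℚ) * ((p : ℚ) ^ n * _root_.bernoulli n) = (p : ℚ) ^ j * c := by
    intro n
    rcases lt_or_ge n (p - 1) with h | h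
    · obtain ⟨d, hd⟩ := hg n h
      rw [hd]
      refine ⟨d * (p : ℚ) ^ (n - j) * _root_.bernoulli n, mul_mem (mul_mem (intCast_mem _ _)
        (Subring.pow_mem _ (natCast_mem _ _) _)) (bernoulli_mem_pIntegers_of_lt h), ?_⟩
      have : (p : ℚ) ^ (j - n) * (p : ℚ) ^ n = (p : ℚ) ^ j * (p : ℚ) ^ (n - j) := by
        rw [← pow_add, ← pow_add]; congr 1; omega
      push_cast
      linear_combination (d * _root_.bernoulli n : ℚ) * this
    · refine ⟨g.coeff n * (p : ℚ) ^ (n - 1 - j) * (p * _root_.bernoulli n), mul_mem (mul_mem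
        (intCast_mem _ _) (Subring.pow_mem _ (natCast_mem _ _) _))
        (natCast_mul_bernoulli_mem_pIntegers hp2 n), ?_⟩
      have : (p : ℚ) ^ n = (p : ℚ) ^ j * (p : ℚ) ^ (n - 1 - j) * p := by
        rw [← pow_add, ← pow_succ]; congr 1; have := hp.out.two_le; omega
      rw [this]; ring
  choose c hc h using key
  refine ⟨∑ n ∈ g.support, c n, sum_mem fun n _ => hc n, ?_⟩
  rw [momentFunctional_apply, Polynomial.sum, Finset.mul_sum]
  exact Finset.sum_congr rfl fun n _ => h n

open Polynomial in
/-- The sequence `p B_{(p-1)s}` corrected at `s = 0`. -/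
lemma hasDivisibleDifferences_bernoulli (hp2 : p ≠ 2) :
    HasDivisibleDifferences (pIntegers p) p (p - 2)
      fun s => p * _root_.bernoulli ((p - 1) * s) - if s = 0 then 1 else 0 := by
  have hp0 : (p : ℚ) ≠ 0 := by exact_mod_cast hp.out.ne_zero
  have hp1 := hp.out.two_le
  set F : ℕ → ℕ → ℤ[X] := fun j s => (X ^ (p - 1)) ^ s * (X ^ (p - 1) - 1) ^ j with hF
  -- Subtracting `f.coeff 0` produces the correction at `s = 0` and cancels the constant term of the
  -- `a = 0` summand in the distribution relation.
  set lam : ℤ[X] → ℚ := fun f => p * momentFunctional _root_.bernoulli f - f.coeff 0 with hlam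
  have hrec : ∀ j s, F (j + 1) s = F j (s + 1) - F j s := fun j s => by simp only [hF]; ring
  have hlam_sub : ∀ f g, lam (f - g) = lam f - lam g := fun f g => by
    simp only [hlam, map_sub, coeff_sub]; push_cast; ring
  have hdiv : ∀ j ≤ p - 2, ∀ s, ∃ c ∈ pIntegers p, lam (F j s) = (p : ℚ) ^ j * c := by
    intro j hj s
    have hterm : ∀ a : ℕ, ∃ c ∈ pIntegers p, a < p →
        momentFunctional (fun n => (p : ℚ) ^ n * _root_.bernoulli n) ((F j s).comp (X + C (a : ℤ)))
          - (if a = 0 then ((F j s).coeff 0 : ℚ) else 0) = (p : ℚ) ^ j * c := by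
      intro a
      rcases Nat.eq_zero_or_pos a with rfl | ha
      · obtain ⟨c, hc, h⟩ := momentFunctional_mem_pow hp2 hj
          (g := F j s - C ((F j s).coeff 0)) (fun n hn => by
            -- For `a = 0`, `F j s` is a polynomial in `X^(p-1)`: without its constant term it has
            -- no coefficient below degree `p-1`.
            have hexp : F j s = expand ℤ (p - 1) (X ^ s * (X - 1) ^ j) := by simp [hF]
            rcases Nat.eq_zero_or_pos n with rfl | hn0
            · simp
            · rw [coeff_sub, coeff_C_of_ne_zero hn0.ne', hexp, coeff_expand (by omega),
                if_neg (Nat.not_dvd_of_pos_of_lt hn0 hn)]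
              simp)
        refine ⟨c, hc, fun _ => ?_⟩
        rw [← h, map_sub, ← monomial_zero_left (a := (F j s).coeff 0),
          momentFunctional_monomial]
        simp
      · by_cases hap : a < p
        -- For `0 < a < p`, Fermat puts `(X + a)^(p-1) - 1` in the ideal `(p, X)`, hence its `j`-th
        -- power in `(p, X)^j`.
        · have h1 : MemPowIdeal p 1 ((X ^ (p - 1) - 1 : ℤ[X]).comp (X + C (a : ℤ))) := by
            intro n
            rcases Nat.eq_zero_or_pos n with rfl | hn0
            · rw [coeff_zero_eq_eval_zero, eval_comp]
              simp only [eval_sub, eval_pow, eval_X, eval_one, eval_add, eval_C, zero_add,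
                tsub_zero, pow_one]
              refine (Int.ModEq.dvd (Int.ModEq.pow_card_sub_one_eq_one hp.out ?_).symm)
              rw [Nat.isCoprime_iff_coprime]
              exact ((Nat.coprime_of_lt_prime ha.ne' hap hp.out).symm)
            · rw [Nat.sub_eq_zero_of_le hn0, pow_zero]; exact one_dvd _
          obtain ⟨c, hc, h⟩ := momentFunctional_mem_pow hp2 hj
            (g := (F j s).comp (X + C (a : ℤ))) (fun n _ => by
              simp only [hF, mul_comp, pow_comp]
              have := (MemPowIdeal.zero p (((X : ℤ[X]).comp (X + C (a : ℤ)) ^ (p - 1)) ^ s)).mul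
                (h1.pow j) n
              rw [zero_add] at this
              simpa only [sub_comp, pow_comp] using this)
          exact ⟨c, hc, fun _ => by rw [h, if_neg ha.ne', sub_zero]⟩
        · exact ⟨0, zero_mem _, fun h => absurd h hap⟩
    choose c hc h using hterm
    refine ⟨∑ a ∈ Finset.range p, c a, sum_mem fun a _ => hc a, ?_⟩
    rw [hlam, Finset.mul_sum,
      ← Finset.sum_congr rfl fun a ha => h a (Finset.mem_range.1 ha), Finset.sum_sub_distrib,
      ← momentFunctional_bernoulli_distribution hp.out.ne_zero]
    simp [hp.out.pos]
  have h := HasDivisibleDifferences.of_iterated_differences (R := pIntegers p) (p := p)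
    (M := p - 2) (fun j s => lam (F j s) / (p : ℚ) ^ j) (fun j hj s => by
      obtain ⟨c, hc, h⟩ := hdiv j hj s
      rwa [h, mul_div_cancel_left₀ _ (pow_ne_zero _ hp0)])
    (fun j s => by rw [hrec, hlam_sub]; field_simp; ring)
  refine h.congr fun s => ?_
  simp only [hF, hlam, pow_zero, mul_one, div_one, ← pow_mul, momentFunctional_X_pow, coeff_X_pow]
  have : (0 = (p - 1) * s) ↔ s = 0 := by
    rw [eq_comm, mul_eq_zero]; omega
  simp [this]

end Prime
-- Integral modular forms and their products.
section ModularForms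

open UpperHalfPlane

/-- `integralModularForms` as an additive subgroup of the power series. -/
noncomputable def integralModularFormsAddSubgroup (p : ℕ) [Fact p.Prime] (k : ℤ) :
    AddSubgroup (PowerSeries ℚ) where
  carrier := integralModularForms p k
  zero_mem' := ⟨fun n => by simpa using mem_pIntegers.1 (zero_mem (pIntegers p)), 0, by
    rw [map_zero]; exact qExpansion_zero 1⟩
  add_mem' := by
    rintro f g ⟨hf, F, hF⟩ ⟨hg, G, hG⟩
    refine ⟨fun n => ?_, F + G, ?_⟩
    · rw [map_add, ← mem_pIntegers]
      exact add_mem (mem_pIntegers.2 (hf n)) (mem_pIntegers.2 (hg n))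
    · rw [map_add, ← hF, ← hG]
      exact ModularForm.qExpansion_add one_pos one_mem_strictPeriods_SL F G
  neg_mem' := by
    rintro f ⟨hf, F, hF⟩
    refine ⟨fun n => ?_, -F, ?_⟩
    · rw [map_neg, ← mem_pIntegers]
      exact neg_mem (mem_pIntegers.2 (hf n))
    · rw [map_neg, ← hF]
      exact ModularForm.qExpansion_neg one_pos one_mem_strictPeriods_SL F

/-- The power series with `p`-integral coefficients. -/
noncomputable def pIntegralSeries (p : ℕ) [Fact p.Prime] : Subring (PowerSeries ℚ) :=
  (PowerSeries.map (pIntegers p).subtype).range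

variable {p : ℕ} [hp : Fact p.Prime]

lemma mem_pIntegralSeries {f : PowerSeries ℚ} :
    f ∈ pIntegralSeries p ↔ ∀ n, PowerSeries.coeff n f ∈ pIntegers p := by
  constructor
  · rintro ⟨g, rfl⟩ n
    simp
  · intro h
    exact ⟨PowerSeries.mk fun n => ⟨_, h n⟩, by ext n; simp⟩

lemma one_mem_integralModularForms : (1 : PowerSeries ℚ) ∈ integralModularForms p 0 :=
  ⟨fun n => mem_pIntegers.1 (mem_pIntegralSeries.1 (one_mem _) n), 1, by
    rw [map_one]; exact ModularForm.qExpansion_one⟩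

lemma mul_mem_integralModularForms {a b : ℤ} {f g : PowerSeries ℚ}
    (hf : f ∈ integralModularForms p a) (hg : g ∈ integralModularForms p b) :
    f * g ∈ integralModularForms p (a + b) := by
  obtain ⟨hf, F, hF⟩ := hf
  obtain ⟨hg, G, hG⟩ := hg
  refine ⟨fun n => mem_pIntegers.1 (mem_pIntegralSeries.1 (mul_mem ?_ ?_) n), F.mul G, ?_⟩
  · exact mem_pIntegralSeries.2 fun n => mem_pIntegers.2 (hf n)
  · exact mem_pIntegralSeries.2 fun n => mem_pIntegers.2 (hg n)
  · rw [map_mul, ← hF, ← hG]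
    exact ModularForm.qExpansion_mul one_pos one_mem_strictPeriods_SL F G

lemma pow_mem_integralModularForms {a : ℤ} {f : PowerSeries ℚ}
    (hf : f ∈ integralModularForms p a) (n : ℕ) :
    f ^ n ∈ integralModularForms p (n * a) := by
  induction n with
  | zero => simpa using one_mem_integralModularForms
  | succ n ih =>
    rw [pow_succ, show ((n + 1 : ℕ) : ℤ) * a = n * a + a by push_cast; ring]
    exact mul_mem_integralModularForms ih hf

lemma exists_qExpansion_eq_eisensteinSeriesE {k : ℕ} (hk : 3 ≤ k) (hk2 : Even k) :
    ∃ F : ModularForm 𝒮ℒ k,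
      qExpansion 1 F = PowerSeries.map (algebraMap ℚ ℂ) (eisensteinSeriesE k) := by
  refine ⟨ModularForm.E hk, ?_⟩
  ext n
  rw [EisensteinSeries.E_qExpansion_coeff hk hk2, PowerSeries.coeff_map, eisensteinSeriesE,
    if_neg (show k ≠ 0 by omega), PowerSeries.coeff_mk]
  split_ifs <;> simp

end ModularForms

/-! ### `p`-adic regularity of the Eisenstein family and the congruence. -/

section Eisenstein

variable {p : ℕ} [hp : Fact p.Prime]

lemma HasDivisibleDifferences.of_coeff {M : ℕ} {f : ℕ → PowerSeries ℚ}
    (h : ∀ n, HasDivisibleDifferences (pIntegers p) p M fun s => PowerSeries.coeff n (f s)) :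
    HasDivisibleDifferences (pIntegralSeries p) p M f := by
  have h0 : ∀ s, f s ∈ pIntegralSeries p := fun s => mem_pIntegralSeries.2 fun n => (h n).mem s
  induction M generalizing f with
  | zero => exact h0
  | succ M ih =>
    choose _ g hg h' using h
    refine ⟨h0, fun s => PowerSeries.mk fun n => g n s, ih (by simpa using hg) fun s =>
      mem_pIntegralSeries.2 fun n => by simpa using (hg n).mem s, fun s => ?_⟩
    ext n
    have h1 : PowerSeries.coeff n (f (s + 1)) = PowerSeries.coeff n (f s) + p * g n s := h' n s
    rw [h1, map_add, ← nsmul_eq_mul p (PowerSeries.mk _), map_nsmul, PowerSeries.coeff_mk,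
      nsmul_eq_mul]

/-- The sequence is constant modulo `p`, since its first differences are divisible by `p`, and its
value at `s = 0` is `p - 1 ≡ -1`. -/
lemma inv_bernoulli_sub_mem (hp5 : 5 ≤ p) (s : ℕ) :
    p * bernoulli ((p - 1) * s) - (if s = 0 then 1 else 0) ≠ 0 ∧
      (p * bernoulli ((p - 1) * s) - (if s = 0 then 1 else 0))⁻¹ ∈ pIntegers p := by
  obtain ⟨N, hN⟩ : ∃ N, p - 2 = N + 1 := ⟨p - 3, by omega⟩
  have h := hasDivisibleDifferences_bernoulli (p := p) (by omega)
  rw [hN] at h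
  obtain ⟨_, g, hg, h⟩ := h
  have key : ∃ c ∈ pIntegers p,
      p * bernoulli ((p - 1) * s) - (if s = 0 then 1 else 0) = ((-1 : ℤ) : ℚ) + p * c := by
    induction s with
    | zero => exact ⟨1, one_mem _, by simp; ring⟩
    | succ s ih =>
      obtain ⟨c, hc, h1⟩ := ih
      exact ⟨c + g s, add_mem hc (hg.mem s), (h s).trans (by simp only [h1]; ring)⟩
  obtain ⟨c, hc, h1⟩ := key
  refine inv_mem_pIntegers (fun hd => ?_) hc h1
  exact hp.out.one_lt.ne' (by simpa [Int.natCast_dvd] using hd)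

lemma hasDivisibleDifferences_mul_pow {h : ℕ → ℚ}
    (hh : HasDivisibleDifferences (pIntegers p) p (p - 2) h) {d : ℕ} (hd : 0 < d) :
    HasDivisibleDifferences (pIntegers p) p (p - 1)
      fun r => p * r * h r * (d : ℚ) ^ ((p - 1) * r - 1) := by
  have hp1 := hp.out.two_le
  by_cases hpd : p ∣ d
  · obtain ⟨e, rfl⟩ := hpd
    -- For `p ∣ d` and `r ≥ 1`, the factor `p · d^((p-1)r-1)` is already divisible by `p^(p-1)`. At
    -- `r = 0`, where the exponent truncates, the factor `r` gives zero.
    refine (HasDivisibleDifferences.pow_mul (R := pIntegers p) (p := p) (M := p - 1)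
      (f := fun r => r * h r * (p : ℚ) ^ ((p - 1) * r - 1 - (p - 2)) *
        (e : ℚ) ^ ((p - 1) * r - 1)) fun r => ?_).congr fun r => ?_
    · exact mul_mem (mul_mem (mul_mem (natCast_mem _ _) (hh.mem r))
        (Subring.pow_mem _ (natCast_mem _ _) _)) (Subring.pow_mem _ (natCast_mem _ _) _)
    · rcases Nat.eq_zero_or_pos r with rfl | hr
      · simp
      · have h1 : p - 1 ≤ (p - 1) * r := Nat.le_mul_of_pos_right _ hr
        have h2 : (p : ℚ) * (p : ℚ) ^ ((p - 1) * r - 1) =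
            (p : ℚ) ^ (p - 1) * (p : ℚ) ^ ((p - 1) * r - 1 - (p - 2)) := by
          rw [← pow_succ', ← pow_add]; congr 1; omega
        push_cast
        rw [mul_pow]
        linear_combination (r * h r * (e : ℚ) ^ ((p - 1) * r - 1)) * h2
  · have hd0 : (d : ℚ) ≠ 0 := by exact_mod_cast hd.ne'
    obtain ⟨y, hy⟩ : (p : ℤ) ∣ (d : ℤ) ^ (p - 1) - 1 :=
      (Int.ModEq.pow_card_sub_one_eq_one hp.out (Nat.isCoprime_iff_coprime.2
        ((Nat.Prime.coprime_iff_not_dvd hp.out).2 hpd).symm)).symm.dvd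
    have hy' : (d : ℚ) ^ (p - 1) = 1 + p * (y : ℚ) := by
      have : ((d : ℚ) ^ (p - 1) - 1) = p * y := by exact_mod_cast hy
      linarith
    have h1 := hh.natCast_mul
    rw [show p - 2 + 1 = p - 1 by omega] at h1
    -- For `p ∤ d`, `d^((p-1)r-1) = d⁻¹ (d^(p-1))^r` is geometric with ratio `≡ 1 (mod p)`; the
    -- truncated exponent at `r = 0` is again masked by the factor `r`.
    refine (h1.mul ((HasDivisibleDifferences.const (p - 1)
      (inv_natCast_mem_pIntegers hpd)).mul (HasDivisibleDifferences.geom (p - 1)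
        (intCast_mem (pIntegers p) y)))).congr fun r => ?_
    rcases Nat.eq_zero_or_pos r with rfl | hr
    · simp
    · have h1 : 0 < (p - 1) * r := Nat.mul_pos (by omega) hr
      rw [← hy', ← pow_mul, ← pow_sub_one_mul h1.ne' (d : ℚ)]
      field_simp

/-- The Eisenstein series of weight divisible by `p - 1` form a `p`-adically regular family. -/
lemma hasDivisibleDifferences_eisensteinSeriesE (hp5 : 5 ≤ p) :
    HasDivisibleDifferences (pIntegralSeries p) p (p - 1)
      fun r => eisensteinSeriesE ((p - 1) * r) := by
  refine HasDivisibleDifferences.of_coeff fun n => ?_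
  rcases Nat.eq_zero_or_pos n with rfl | hn
  · refine (HasDivisibleDifferences.const (p - 1) (one_mem (pIntegers p))).congr fun r => ?_
    rw [eisensteinSeriesE]
    split_ifs <;> simp
  have hinv := (hasDivisibleDifferences_bernoulli (p := p) (by omega)).inv
    (fun s => (inv_bernoulli_sub_mem hp5 s).1) (fun s => (inv_bernoulli_sub_mem hp5 s).2)
  refine ((HasDivisibleDifferences.const (p - 1) (c := -(2 * ((p - 1 : ℕ) : ℚ)))
    (neg_mem (mul_mem (ofNat_mem _ 2) (natCast_mem _ _)))).mul
    (HasDivisibleDifferences.sum n.divisors fun d hd =>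
      hasDivisibleDifferences_mul_pow hinv (Nat.pos_of_mem_divisors hd))).congr fun r => ?_
  rcases Nat.eq_zero_or_pos r with rfl | hr
  · simp [eisensteinSeriesE, PowerSeries.coeff_one, hn.ne']
  · have hk : (p - 1) * r ≠ 0 := (Nat.mul_pos (by omega) hr).ne'
    have hp0 : (p : ℚ) ≠ 0 := by exact_mod_cast hp.out.ne_zero
    rw [eisensteinSeriesE, if_neg hk, PowerSeries.coeff_mk, if_neg hn.ne', ← Finset.mul_sum,
      if_neg hr.ne', sub_zero, ArithmeticFunction.sigma_apply, mul_inv]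
    push_cast
    field_simp

lemma eisensteinSeriesE_mem_integralModularForms (hp5 : 5 ≤ p) (r : ℕ) :
    eisensteinSeriesE ((p - 1) * r) ∈ integralModularForms p (((p - 1 : ℕ) : ℤ) * r) := by
  rcases Nat.eq_zero_or_pos r with rfl | hr
  · simpa [eisensteinSeriesE] using one_mem_integralModularForms
  · refine ⟨fun n => mem_pIntegers.1 (mem_pIntegralSeries.1
      ((hasDivisibleDifferences_eisensteinSeriesE hp5).mem r) n), ?_⟩
    rw [← Nat.cast_mul]
    refine exists_qExpansion_eq_eisensteinSeriesE ?_ ?_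
    · have : p - 1 ≤ (p - 1) * r := Nat.le_mul_of_pos_right _ hr
      omega
    · exact (hp.out.even_sub_one (by omega)).mul_right r

/-- Modulo `p ^ m`, an Eisenstein series of weight `(p - 1) r` is a power of `E_{p-1}` times a form
of weight `(p - 1)(m - 1)`. -/
lemma eisensteinSeriesE_congr_pow_mul (hp5 : 5 ≤ p) {m r : ℕ} (hm : m < p - 1) (hr : m ≤ r) :
    ∃ g ∈ integralModularForms p (((p - 1 : ℕ) : ℤ) * m),
      CongrModPow p (m + 1) (eisensteinSeriesE ((p - 1) * r))
        (eisensteinSeriesE (p - 1) ^ (r - m) * g) := by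
  set e := eisensteinSeriesE (p - 1) with he
  set f : ℕ → PowerSeries ℚ := fun r => eisensteinSeriesE ((p - 1) * r) with hf
  have hfam := hasDivisibleDifferences_eisensteinSeriesE hp5
  obtain ⟨N, hN⟩ : ∃ N, p - 1 = (m + N) + 1 := ⟨p - 1 - m - 1, by omega⟩
  have hfm : HasDivisibleDifferences (pIntegralSeries p) p (m + 1) f := by
    have : ∀ N, HasDivisibleDifferences (pIntegralSeries p) p (m + N + 1) f →
        HasDivisibleDifferences (pIntegralSeries p) p (m + 1) f := by
      intro N
      induction N with
      | zero => exact id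
      | succ N ih => exact fun h => ih h.of_succ
    exact this N (by rw [← hN]; exact hfam)
  obtain ⟨y, hy, hey⟩ : ∃ y ∈ pIntegralSeries p, e = 1 + p * y := by
    obtain ⟨_, g, hg, h⟩ := hfm
    refine ⟨g 0, hg.mem 0, ?_⟩
    have h0 : eisensteinSeriesE ((p - 1) * 0) = 1 := by simp [eisensteinSeriesE]
    simpa only [hf, zero_add, mul_one, h0, he] using h 0
  obtain ⟨c, hc, h⟩ := hfm.newton_congr hy hey (r := r) (by omega)
  have hmem : ∀ i : ℕ, f i ∈ integralModularForms p (((p - 1 : ℕ) : ℤ) * i) :=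
    eisensteinSeriesE_mem_integralModularForms hp5
  have hemem : e ∈ integralModularForms p ((p - 1 : ℕ) : ℤ) := by simpa [hf] using hmem 1
  -- The witness is the Newton sum with `e^(r-m)` removed, possible because `j ≤ m ≤ r`. The
  -- exponents `m-j`, `j-i` and the index `i` add up to `m`, so all terms have weight `(p-1)m`.
  refine ⟨∑ j ∈ Finset.range (m + 1), ∑ i ∈ Finset.range (j + 1),
    ((r.choose j : ℤ) * (j.choose i : ℤ) * (-1) ^ (j - i)) •
      (e ^ (m - j) * e ^ (j - i) * f i), ?_, fun n => ?_⟩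
  · refine sum_mem (S := integralModularFormsAddSubgroup p (((p - 1 : ℕ) : ℤ) * m))
      fun j hj => sum_mem fun i hi => zsmul_mem ?_ _
    rw [Finset.mem_range] at hj hi
    have := mul_mem_integralModularForms (mul_mem_integralModularForms
      (pow_mem_integralModularForms hemem (m - j)) (pow_mem_integralModularForms hemem (j - i)))
      (hmem i)
    rw [Nat.cast_sub (by omega : j ≤ m), Nat.cast_sub (by omega : i ≤ j)] at this
    have hw : ((m : ℤ) - j) * ((p - 1 : ℕ) : ℤ) + (j - i) * ((p - 1 : ℕ) : ℤ) +
        ((p - 1 : ℕ) : ℤ) * i = ((p - 1 : ℕ) : ℤ) * m := by ring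
    rwa [hw] at this
  · refine ⟨PowerSeries.coeff n c, mem_pIntegers.1 (mem_pIntegralSeries.1 hc n), ?_⟩
    rw [← map_sub]
    have : f r - e ^ (r - m) * ∑ j ∈ Finset.range (m + 1), ∑ i ∈ Finset.range (j + 1),
        ((r.choose j : ℤ) * (j.choose i : ℤ) * (-1) ^ (j - i)) •
        (e ^ (m - j) * e ^ (j - i) * f i) = ((p ^ (m + 1) : ℕ) : PowerSeries ℚ) * c := by
      rw [h, sub_eq_iff_eq_add', Finset.mul_sum, Nat.cast_pow]
      congr 1
      refine Finset.sum_congr rfl fun j hj => ?_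
      rw [Finset.mem_range] at hj
      rw [Finset.mul_sum, Finset.mul_sum]
      refine Finset.sum_congr rfl fun i hi => ?_
      rw [show r - j = (r - m) + (m - j) by omega, pow_add, neg_pow e, zsmul_eq_mul]
      push_cast
      ring
    rw [this, ← nsmul_eq_mul, map_nsmul, nsmul_eq_mul, Nat.cast_pow]

end Eisenstein

theorem corollary1p4 (p : ℕ) (hp : p.Prime) (hp5 : 5 ≤ p) (k m : ℕ) (hk : p - 1 ∣ k)
    (hm1 : 1 ≤ m) (hm : m ≤ p - 1) :
    eisensteinSeriesE k ∈ integralModularForms p (k : ℤ) ∧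
      factorFiltration p m (eisensteinSeriesE k) ≤
        (((((m : ℤ) - 1) * ((p : ℤ) - 1) : ℤ) : ℝ) : EReal) := by
  have : Fact p.Prime := ⟨hp⟩
  obtain ⟨r, rfl⟩ := hk
  obtain ⟨m, rfl⟩ := Nat.exists_eq_add_of_le' hm1
  have hmem := eisensteinSeriesE_mem_integralModularForms hp5 r
  have hcast : ((p - 1 : ℕ) : ℤ) = (p : ℤ) - 1 := by rw [Nat.cast_sub hp.one_le, Nat.cast_one]
  refine ⟨by rw [Nat.cast_mul]; exact hmem, ?_⟩
  rw [factorFiltration]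
  -- `m` is now one less than in the statement. If `r ≤ m`, the form `E_k` itself already has weight
  -- at most `(p-1)m`, and the zeroth power of `E_{p-1}` suffices.
  rcases le_total m r with hr | hr
  · obtain ⟨g, hg, h⟩ := eisensteinSeriesE_congr_pow_mul hp5 (by omega : m < p - 1) hr
    refine sInf_le ⟨_, ?_, r - m, g, hg, h⟩
    rw [hcast]; congr 2; push_cast; ring
  · refine le_trans (b := (((((p - 1 : ℕ) : ℤ) * r : ℤ) : ℝ) : EReal)) ?_ ?_
    · exact sInf_le ⟨_, rfl, 0, _, hmem,
        fun n => ⟨0, mem_pIntegers.1 (zero_mem (pIntegers p)), by simp⟩⟩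
    · rw [EReal.coe_le_coe_iff, Int.cast_le, hcast, mul_comm]
      refine mul_le_mul_of_nonneg_right (by push_cast; omega) (by omega)
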